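/- Let $\mathcal X\subset\mathbb R^{n_x}$ be compact and let $\mathcal O\supset\mathcal X$ be a bounded open set on which $f$ (with values in $\mathbb R^{n_x}$) and $h$ (with values in $\mathbb R^{n_y}$) are smooth. Assume: 1. $\dot x=f(x)$ is forward complete within $\mathcal X$: from every $x_0\in\mathcal X$ the trajectory $x(t;x_0)$ is defined and stays in $\mathcal X$ for all $t\ge 0$. 2. The system is backward $\mathcal O$-distinguishable on $\mathcal X$: for all $x_0^1\ne x_0^2$ in $\mathcal X$ there is $\tau<0$ such that both trajectories $x(t;x_0^i)$ are defined and stay in $\mathcal O$ for $t\in[\tau,0]$, and $h(x(\tau;x_0^1))\neq h(x(\tau;x_0^2))$. Let $n_z=n_y(2n_x+1)$, let $A\in\mathbb R^{n_z\times n_z}$ be Hurwitz and let $B\in\mathbb R^{n_z\times n_y}$ be such that $(A,B)$ is controllable. Let $\mathcal T:\mathcal X\to\mathbb R^{n_z}$ be continuously differentiable, uniformly injective (there is a class-$\mathcal K$ function $\rho$ with $\|x_1-x_2\|\le\rho(\|\mathcal T(x_1)-\mathcal T(x_2)\|)$ for all $x_1,x_2\in\mathcal X$), and a solution of $\frac{\partial\mathcal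 T}{\partial x}(x)f(x)=A\mathcal T(x)+Bh(x)$ on $\mathcal X$. Let $\mathcal T^*:\mathbb R^{n_z}\to\mathbb R^{n_x}$ be a left inverse, $\mathcal T^*(\mathcal T(x))=x$ for $x\in\mathcal X$. Let $\hat{\mathcal T}^*:\mathbb R^{n_z}\to\mathbb R^{n_x}$ be a feedforward neural network with Lipschitz continuous activation functions, and let $\mathcal E^*=\mathcal T^*-\hat{\mathcal T}^*$ be its approximation error. Here "continuously differentiable on $\mathcal X$" means that $\mathcal T$ has at every point of $\mathcal X$ a derivative relative to $\mathcal X$ that can be chosen continuous on $\mathcal X$. Call a compact set $\mathcal Z\subset\mathbb R^{n_z}$ admissible if it contains, for every $x_0\in\mathcal X$ and $t\ge0$, the point $z(t)$ of the solution of $\dot z=Az+Bh(x(t;x_0))$, $z(0)=\mathcal T(x_0)$, and put $\epsilon^*=\sup_{z\in\mathcal Z}\|\mathcal E^*(z)\|$. Then there is an admissible $\mathcal Z$ with $\epsilon^*<\infty$. Moreover, there are constants $c,\alpha_1,\alpha_2>0$ and, for every $\hat z_0\in\mathbb R^{n_z}$, a constant $b>0$, such that the following holds for every admissible $\mathcal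 Z$ with $\epsilon^*<\infty$, all $\bar w,\bar v\ge0$ and all measurable signals $w,v$ on $[0,\infty)$ with $\|w\|_{L^\infty}\le\bar w$ and $\|v\|_{L^\infty}\le\bar v$ (the essential supremum of the maximum norm). Let $x$ be any (Carathéodory) solution of the perturbed system $$\dot x=f(x)+w,\qquad y=h(x)+v$$ that stays in $\mathcal X$ for all $t\ge 0$, and let $\hat x$ be the estimate produced by the learned observer $$\dot{\hat z}=A\hat z+By,\quad \hat z(0)=\hat z_0,\qquad \hat x=\hat{\mathcal T}^*(\hat z).$$ Then $\tilde x(t)=\hat x(t)-x(t)$ satisfies $$\|\tilde x(t)\|\le b\,e^{-ct}+\alpha_1\bar w+\alpha_2\bar v+\epsilon^*\qquad\text{for all }t\ge0.$$ -/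

import Mathlib

open Set MeasureTheory
open scoped NNReal ENNReal ContDiff Matrix

namespace KKL

/-- Euclidean space of dimension `n`. -/
abbrev Vec (n : ℕ) : Type := EuclideanSpace ℝ (Fin n)

/-! ### Solutions and signals -/

/-- `x` is a Caratheodory solution on `[0, ∞)` of `x' = F(t, x)`, `x(0) = x₀`:
it is continuous and satisfies the integral equation, with a locally integrable right-hand side. -/
def IsCaratheodorySolution {n : ℕ} (F : ℝ → Vec n → Vec n) (x₀ : Vec n) (x : ℝ → Vec n) : Prop :=
  ContinuousOn x (Ici 0) ∧
  ∀ t : ℝ, 0 ≤ t →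
    IntervalIntegrable (fun s => F s (x s)) volume 0 t ∧
    x t = x₀ + ∫ s in (0 : ℝ)..t, F s (x s)

/-- The `L^∞` norm of a signal on the time axis `[0, ∞)`, with the maximum norm on values:
`inf {c ≥ 0 : ‖w t‖_∞ ≤ c for almost every t ≥ 0}`. -/
noncomputable def linfNorm {n : ℕ} (w : ℝ → Vec n) : ℝ≥0∞ :=
  eLpNorm (fun t => (WithLp.ofLp (w t) : Fin n → ℝ)) ∞ (volume.restrict (Ici 0))

/-- `w` is a measurable signal on `[0, ∞)` with `‖w‖_{L^∞} ≤ wbar`. -/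
def IsSignalBoundedBy {n : ℕ} (w : ℝ → Vec n) (wbar : ℝ) : Prop :=
  AEStronglyMeasurable w (volume.restrict (Ici 0)) ∧ 0 ≤ wbar ∧ linfNorm w ≤ ENNReal.ofReal wbar

/-! ### The standing assumptions on the nominal system `x' = f(x)`, `y = h(x)` -/

/-- `x` is a forward trajectory of `x' = f(x)` from `x₀`, defined on `[0, ∞)` with values in `X`. -/
def IsTrajectoryIn {nx : ℕ} (f : Vec nx → Vec nx) (X : Set (Vec nx)) (x₀ : Vec nx)
    (x : ℝ → Vec nx) : Prop :=
  x 0 = x₀ ∧ IsIntegralCurveOn x (fun _ => f) (Ici 0) ∧ ∀ t : ℝ, 0 ≤ t → x t ∈ X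

/-- Forward completeness within `X`. -/
def ForwardCompleteWithin {nx : ℕ} (f : Vec nx → Vec nx) (X : Set (Vec nx)) : Prop :=
  ∀ x₀ ∈ X, ∃ x : ℝ → Vec nx, IsTrajectoryIn f X x₀ x

/-- Backward `O`-distinguishability on `X`: two distinct initial conditions in `X` have backward
trajectories that both exist and stay in `O` on some `[τ, 0]`, `τ < 0`, and whose outputs at
time `τ` differ. -/
def BackwardDistinguishable {nx ny : ℕ} (f : Vec nx → Vec nx) (h : Vec nx → Vec ny)
    (O X : Set (Vec nx)) : Prop :=
  ∀ x₁ ∈ X, ∀ x₂ ∈ X, x₁ ≠ x₂ →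
    ∃ τ : ℝ, τ < 0 ∧ ∃ ξ₁ ξ₂ : ℝ → Vec nx,
      ξ₁ 0 = x₁ ∧ ξ₂ 0 = x₂ ∧
      IsIntegralCurveOn ξ₁ (fun _ => f) (Icc τ 0) ∧
      IsIntegralCurveOn ξ₂ (fun _ => f) (Icc τ 0) ∧
      (∀ t ∈ Icc τ 0, ξ₁ t ∈ O ∧ ξ₂ t ∈ O) ∧
      h (ξ₁ τ) ≠ h (ξ₂ τ)

/-! ### The linear part of the observer -/

/-- Every complex eigenvalue of the real matrix `A` has negative real part. -/
def IsHurwitz {n : ℕ} (A : Matrix (Fin n) (Fin n) ℝ) : Prop :=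
  ∀ μ ∈ spectrum ℂ (A.map (fun a : ℝ => (a : ℂ))), μ.re < 0

/-- Kalman's condition: the columns of `B, A B, …, A^(n-1) B` span `ℝⁿ`. -/
def IsControllable {n m : ℕ} (A : Matrix (Fin n) (Fin n) ℝ) (B : Matrix (Fin n) (Fin m) ℝ) :
    Prop :=
  (⨆ k : Fin n, LinearMap.range (A ^ (k : ℕ) * B).mulVecLin) = ⊤

/-- The vector field `z ↦ A z + B y(t)` driven by the output signal `y`. -/
noncomputable def linearField {n m : ℕ} (A : Matrix (Fin n) (Fin n) ℝ)
    (B : Matrix (Fin n) (Fin m) ℝ) (y : ℝ → Vec m) : ℝ → Vec n → Vec n :=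
  fun t z => Matrix.toEuclideanLin A z + Matrix.toEuclideanLin B (y t)

/-! ### The transformation map and its left inverse -/

/-- Class `𝓚` functions. -/
def IsClassK (ρ : ℝ≥0 → ℝ≥0) : Prop :=
  Continuous ρ ∧ ρ 0 = 0 ∧ StrictMono ρ

/-- Uniform injectivity on `X`. -/
def UniformlyInjectiveOn {nx nz : ℕ} (T : Vec nx → Vec nz) (X : Set (Vec nx)) : Prop :=
  ∃ ρ : ℝ≥0 → ℝ≥0, IsClassK ρ ∧ ∀ x₁ ∈ X, ∀ x₂ ∈ X, ‖x₁ - x₂‖₊ ≤ ρ ‖T x₁ - T x₂‖₊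

/-- `T` is continuously differentiable on `X` and is a (classical) solution of
`(∂T/∂x)(x) f(x) = A T(x) + B h(x)` for `x ∈ X`. Only the values of `T` on `X` matter. -/
def SolvesPDE {nx ny nz : ℕ} (f : Vec nx → Vec nx) (h : Vec nx → Vec ny)
    (A : Matrix (Fin nz) (Fin nz) ℝ) (B : Matrix (Fin nz) (Fin ny) ℝ) (X : Set (Vec nx))
    (T : Vec nx → Vec nz) : Prop :=
  ∃ DT : Vec nx → (Vec nx →L[ℝ] Vec nz), ContinuousOn DT X ∧
    ∀ x ∈ X, HasFDerivWithinAt T (DT x) X x ∧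
      DT x (f x) = Matrix.toEuclideanLin A (T x) + Matrix.toEuclideanLin B (h x)

/-- `Tinv : ℝ^nz → ℝ^nx` is a left inverse of `T` on `X`. -/
def IsLeftInverseOn {nx nz : ℕ} (T : Vec nx → Vec nz) (X : Set (Vec nx))
    (Tinv : Vec nz → Vec nx) : Prop :=
  ∀ x ∈ X, Tinv (T x) = x

/-! ### Feedforward neural networks -/

/-- Feedforward neural networks from `ℝ^m` to `ℝ^n`: hidden layers `x ↦ σ(W x + b)`, with an
activation function for each neuron, followed by an affine output layer. -/
inductive NeuralNet : ℕ → ℕ → Type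
  | output {m n : ℕ} (W : Matrix (Fin n) (Fin m) ℝ) (b : Vec n) : NeuralNet m n
  | hidden {m k n : ℕ} (W : Matrix (Fin k) (Fin m) ℝ) (b : Vec k) (σ : Fin k → ℝ → ℝ)
      (rest : NeuralNet k n) : NeuralNet m n

/-- The function computed by a network. -/
noncomputable def NeuralNet.eval : {m n : ℕ} → NeuralNet m n → Vec m → Vec n
  | _, _, .output W b, x => Matrix.toEuclideanLin W x + b
  | _, _, .hidden W b σ rest, x =>
      rest.eval (WithLp.toLp 2 fun i => σ i ((Matrix.toEuclideanLin W x + b) i))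

/-- All activation functions of the network are Lipschitz continuous. -/
def NeuralNet.LipschitzActivations : {m n : ℕ} → NeuralNet m n → Prop
  | _, _, .output _ _ => True
  | _, _, .hidden _ _ σ rest => (∀ i, ∃ K : ℝ≥0, LipschitzWith K (σ i)) ∧ rest.LipschitzActivations

/-! ### The approximation bound -/

/-- `Z` is a compact set that contains, for every `x₀ ∈ X`, the trajectory `z(t; T(x₀))`, `t ≥ 0`,
of `z' = A z + B h(x(t; x₀))`, `z(0) = T(x₀)`. -/
def IsObserverRegion {nx ny nz : ℕ} (f : Vec nx → Vec nx) (h : Vec nx → Vec ny)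
    (A : Matrix (Fin nz) (Fin nz) ℝ) (B : Matrix (Fin nz) (Fin ny) ℝ) (X : Set (Vec nx))
    (T : Vec nx → Vec nz) (Z : Set (Vec nz)) : Prop :=
  IsCompact Z ∧
  ∀ x₀ ∈ X, ∀ (x : ℝ → Vec nx) (z : ℝ → Vec nz),
    IsTrajectoryIn f X x₀ x → z 0 = T x₀ →
    IsIntegralCurveOn z (linearField A B (fun t => h (x t))) (Ici 0) →
    ∀ t : ℝ, 0 ≤ t → z t ∈ Z

/-- `ε` is the (finite) supremum over `Z` of the norm of the approximation error
`E*(z) = T*(z) - N(z)` of the network `N` that replaces the left inverse `T*`. -/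
def IsApproximationBound {nx nz : ℕ} (Tinv : Vec nz → Vec nx) (N : NeuralNet nz nx)
    (Z : Set (Vec nz)) (ε : ℝ) : Prop :=
  IsLUB ((fun z => ‖Tinv z - N.eval z‖) '' Z) ε

end KKL

open Filter Topology

namespace KKL

/-! ### Networks with Lipschitz activations -/

/-! In the coordinates `T` the plant becomes the linear filter that the observer copies. Set `e =
zhat - T(x)`. The PDE cancels every nominal term and leaves `e' = A e + d`, where `d` collects `B v`
and `-DT(x) w`. By compactness of `X` its norm is at most a constant times `wbar` plus a constant
times `vbar`. Since `A` is Hurwitz, `‖e‖` decays exponentially up to a multiple of that bound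
(`IsHurwitz.exists_exp_bound`). The network is Lipschitz, so `N(zhat)` follows `N(T(x))`, and
`N(T(x))` differs from `x = Tinv(T(x))` by at most `ε` because `T(X)` lies in every admissible
region (`IsObserverRegion.image_subset`).

The disturbances are merely measurable, so `x` need not be differentiable at every time, and `T` is
differentiable only relative to `X`. Right difference quotients are therefore controlled up to an
error at every time (`HasRightSlopeWithin`). This passes through `T` without an almost-everywhere
chain rule, and it is enough for Grönwall's inequality applied to a norm adapted to `A`. -/

theorem NeuralNet.exists_lipschitzWith_eval {m n : ℕ} (N : NeuralNet m n)
    (hN : N.LipschitzActivations) : ∃ K : ℝ≥0, LipschitzWith K N.eval := by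
  have affine {m n : ℕ} (W : Matrix (Fin n) (Fin m) ℝ) (b : Vec n) :
      ∃ K : ℝ≥0, LipschitzWith K fun x => Matrix.toEuclideanLin W x + b :=
    ⟨_, (LinearMap.toContinuousLinearMap (Matrix.toEuclideanLin W)).lipschitz.add
      (LipschitzWith.const b)⟩
  induction N with
  | output W b => exact affine W b
  | @hidden m k n W b σ rest ih =>
    obtain ⟨hσ, hrest⟩ := hN
    obtain ⟨K, hK⟩ := ih hrest
    obtain ⟨K', hK'⟩ := affine W b
    choose κ hκ using hσ
    -- In the maximum norm a coordinatewise map has the largest `κ i` as Lipschitz constant; the sum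
    -- is a convenient upper bound.
    have hpi : LipschitzWith (∑ i, κ i) fun (u : Fin k → ℝ) i => σ i (u i) := by
      refine LipschitzWith.of_dist_le_mul fun u u' => (dist_pi_le_iff (by positivity)).2 fun i => ?_
      refine ((hκ i).dist_le_mul _ _).trans ?_
      gcongr
      · exact Finset.single_le_sum (f := κ) (fun _ _ => zero_le) (Finset.mem_univ i)
      · exact dist_le_pi_dist u u' i
    exact ⟨_, hK.comp ((PiLp.lipschitzWith_toLp 2 fun _ : Fin k => ℝ).comp
      (hpi.comp ((PiLp.lipschitzWith_ofLp 2 fun _ : Fin k => ℝ).comp hK')))⟩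

/-! ### A seminorm that decays along a Hurwitz matrix -/

section Hurwitz

attribute [local instance] Matrix.linftyOpNormedAddCommGroup Matrix.linftyOpNormedRing
  Matrix.linftyOpNormedAlgebra

/-- `‖1 + hμ‖² = 1 + 2h Re μ + h²‖μ‖²`, and on the compact spectrum `Re μ` is bounded away from `0`
while `‖μ‖` is bounded. A small `h` thus lets the linear term win for all eigenvalues at once. -/
theorem IsHurwitz.exists_forall_norm_one_add_mul_lt {n : ℕ} [NeZero n]
    {A : Matrix (Fin n) (Fin n) ℝ} (hA : IsHurwitz A) :
    ∃ h : ℝ, 0 < h ∧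
      ∀ μ ∈ spectrum ℂ (A.map (fun a : ℝ => (a : ℂ))), ‖1 + (h : ℂ) * μ‖ < 1 := by
  set σ := spectrum ℂ (A.map (fun a : ℝ => (a : ℂ)))
  have hσ : IsCompact σ := spectrum.isCompact _
  obtain ⟨μ₀, hμ₀, hmax⟩ := hσ.exists_isMaxOn (spectrum.nonempty _)
    Complex.continuous_re.continuousOn
  obtain ⟨M, hM⟩ := hσ.isBounded.exists_norm_le
  have h₀ : 0 < -μ₀.re := neg_pos.2 (hA μ₀ hμ₀)
  -- This choice gives `h²M² < -h Re μ₀`, so the quadratic term uses up less than half of the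
  -- decrease `-2h Re μ₀`.
  refine ⟨-μ₀.re / (M ^ 2 + 1), by positivity, fun μ hμ => ?_⟩
  set h := -μ₀.re / (M ^ 2 + 1) with hh
  have hpos : 0 < h := by positivity
  have hmul : h * (M ^ 2 + 1) = -μ₀.re := by rw [hh]; field_simp
  have hre : μ.re ≤ μ₀.re := hmax hμ
  have hsq : μ.re ^ 2 + μ.im ^ 2 ≤ M ^ 2 := by
    have := pow_le_pow_left₀ (norm_nonneg _) (hM μ hμ) 2
    rw [Complex.sq_norm, Complex.normSq_apply] at this
    linarith
  have : ‖1 + (h : ℂ) * μ‖ ^ 2 < 1 := by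
    rw [Complex.sq_norm, Complex.normSq_apply]
    simp only [Complex.add_re, Complex.one_re, Complex.mul_re, Complex.ofReal_re,
      Complex.ofReal_im, zero_mul, sub_zero, Complex.add_im, Complex.one_im, Complex.mul_im,
      zero_add, add_zero]
    have h1 : h * (h * (μ.re ^ 2 + μ.im ^ 2)) ≤ h * (h * M ^ 2) := by gcongr
    have h2 : h * μ.re ≤ h * μ₀.re := by gcongr
    have h3 : h * (h * M ^ 2) = h * (-μ₀.re) - h * h := by rw [← hmul]; ring
    nlinarith [mul_pos hpos h₀, mul_pos hpos hpos]
  exact (sq_lt_one_iff₀ (norm_nonneg _)).1 this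

theorem linfty_opNorm_map_ofReal {m n : ℕ} (M : Matrix (Fin m) (Fin n) ℝ) :
    ‖M.map (fun a : ℝ => (a : ℂ))‖ = ‖M‖ := by
  simp [Matrix.linfty_opNorm_def]

/-- Some power of `1 + h A` is a contraction, for a small step `h`. -/
theorem IsHurwitz.exists_norm_pow_le {n : ℕ} {A : Matrix (Fin n) (Fin n) ℝ} (hA : IsHurwitz A) :
    ∃ h r : ℝ, 0 < h ∧ 0 < r ∧ r < 1 ∧ ∃ m : ℕ, 0 < m ∧ ‖(1 + h • A) ^ m‖ ≤ r ^ m := by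
  rcases Nat.eq_zero_or_pos n with rfl | hn
  · refine ⟨1, 1 / 2, by norm_num, by norm_num, by norm_num, 1, one_pos, ?_⟩
    rw [Subsingleton.elim ((1 + (1 : ℝ) • A) ^ 1) 0, norm_zero]
    positivity
  have : NeZero n := ⟨hn.ne'⟩
  obtain ⟨h, hpos, hh⟩ := hA.exists_forall_norm_one_add_mul_lt
  set Ac := A.map (fun a : ℝ => (a : ℂ)) with hAc
  have hmap : (1 + h • A).map (fun a : ℝ => (a : ℂ)) = 1 + (h : ℂ) • Ac := by
    ext i j
    by_cases hij : i = j <;> simp [hAc, hij]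
  have hrad : spectralRadius ℂ (1 + (h : ℂ) • Ac) < (1 : ℝ≥0) := by
    refine spectrum.spectralRadius_lt_of_forall_lt _ fun z hz => ?_
    rw [← map_one (algebraMap ℂ (Matrix (Fin n) (Fin n) ℂ)), ← spectrum.singleton_add_eq,
      spectrum.smul_eq_smul _ _ (spectrum.nonempty _)] at hz
    obtain ⟨_, rfl, _, ⟨μ, hμ, rfl⟩, rfl⟩ := hz
    exact hh μ hμ
  obtain ⟨r, hr0, hr1⟩ := ENNReal.lt_iff_exists_nnreal_btwn.1 hrad
  -- Gelfand's formula turns the spectral radius bound, obtained over `ℂ`, into a norm bound on a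
  -- single power.
  have hgel := spectrum.pow_nnnorm_pow_one_div_tendsto_nhds_spectralRadius (1 + (h : ℂ) • Ac)
  obtain ⟨m, hm, hm0⟩ := ((hgel.eventually_lt_const hr0).and (eventually_gt_atTop 0)).exists
  refine ⟨h, r, hpos, ?_, by exact_mod_cast hr1, m, hm0, ?_⟩
  · exact_mod_cast pos_of_gt hr0
  · have hle := hm.le
    rw [one_div, ENNReal.rpow_inv_le_iff (by exact_mod_cast hm0), ENNReal.rpow_natCast,
      ← ENNReal.coe_pow, ENNReal.coe_le_coe, ← hmap] at hle
    rw [← linfty_opNorm_map_ofReal]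
    have hmapPow : ((1 + h • A) ^ m).map (fun a : ℝ => (a : ℂ)) =
        (1 + h • A).map (fun a : ℝ => (a : ℂ)) ^ m :=
      map_pow Complex.ofRealHom.mapMatrix (1 + h • A) m
    rw [hmapPow]
    exact_mod_cast hle

/-- The adapted norm is `p v = ∑_{j<m} r⁻ʲ ‖Mʲ v‖` with `M = 1 + hA` and `‖Mᵐ‖ ≤ rᵐ`. Applying `M`
shifts the sum by one index and gains a factor `r`; the new last term `r⁻ᵐ ‖Mᵐ v‖` is at most the
lost first term `‖v‖`. The norms in the sum are maximum norms. -/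
theorem IsHurwitz.exists_seminorm {n : ℕ} {A : Matrix (Fin n) (Fin n) ℝ} (hA : IsHurwitz A) :
    ∃ (p : Seminorm ℝ (Vec n)) (h r C₁ C₂ : ℝ), 0 < h ∧ r < 1 ∧ 0 < C₁ ∧ 0 < C₂ ∧
      (∀ v, ‖v‖ ≤ C₁ * p v) ∧ (∀ v, p v ≤ C₂ * ‖v‖) ∧
      ∀ v, p (v + h • Matrix.toEuclideanLin A v) ≤ r * p v := by
  obtain ⟨h, r, hh, hr0, hr1, m, hm, hpow⟩ := hA.exists_norm_pow_le
  set M := 1 + h • A with hM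
  let φ : Vec n → ℝ := fun v => ∑ j ∈ Finset.range m, (r ^ j)⁻¹ * ‖(M ^ j) *ᵥ v.ofLp‖
  have hadd (u v : Vec n) : φ (u + v) ≤ φ u + φ v := by
    simp only [φ, ← Finset.sum_add_distrib, ← mul_add]
    refine Finset.sum_le_sum fun j _ => ?_
    rw [WithLp.ofLp_add, Matrix.mulVec_add]
    gcongr
    exact norm_add_le _ _
  have hsmul (a : ℝ) (v : Vec n) : φ (a • v) = ‖a‖ * φ v := by
    simp only [φ, Finset.mul_sum]
    refine Finset.sum_congr rfl fun j _ => ?_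
    rw [WithLp.ofLp_smul, Matrix.mulVec_smul, norm_smul]
    ring
  obtain ⟨K₁, hK₁⟩ : ∃ K : ℝ≥0, LipschitzWith K (WithLp.toLp 2 : (Fin n → ℝ) → Vec n) :=
    ⟨_, PiLp.lipschitzWith_toLp 2 _⟩
  have hK₂ : LipschitzWith 1 (WithLp.ofLp : Vec n → (Fin n → ℝ)) := PiLp.lipschitzWith_ofLp 2 _
  refine ⟨Seminorm.of φ hadd hsmul, h, r, K₁ + 1,
    ∑ j ∈ Finset.range m, (r ^ j)⁻¹ * ‖M ^ j‖ + 1, hh, hr1, by positivity,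
    by positivity, fun v => ?_, fun v => ?_, fun v => ?_⟩
  · have h1 : ‖v.ofLp‖ ≤ φ v := by
      have := Finset.single_le_sum (f := fun j => (r ^ j)⁻¹ * ‖(M ^ j) *ᵥ v.ofLp‖)
        (fun j _ => by positivity) (Finset.mem_range.2 hm)
      simpa using this
    have h2 : ‖v‖ ≤ K₁ * ‖v.ofLp‖ := by
      simpa using hK₁.dist_le_mul v.ofLp 0
    have h3 : 0 ≤ φ v := (norm_nonneg _).trans h1
    change ‖v‖ ≤ (K₁ + 1) * φ v
    nlinarith [mul_le_mul_of_nonneg_left h1 K₁.coe_nonneg]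
  · have h2 : ‖v.ofLp‖ ≤ ‖v‖ := by simpa using hK₂.dist_le_mul v 0
    change φ v ≤ _
    rw [add_mul, one_mul, Finset.sum_mul]
    refine (Finset.sum_le_sum fun j _ => ?_).trans (le_add_of_nonneg_right (norm_nonneg v))
    rw [mul_assoc]
    gcongr
    exact (Matrix.linfty_opNorm_mulVec _ _).trans (by gcongr)
  · have hv : (v + h • Matrix.toEuclideanLin A v).ofLp = M *ᵥ v.ofLp := by
      simp [hM, Matrix.add_mulVec, Matrix.smul_mulVec, Matrix.toLpLin_apply]
    change φ _ ≤ r * φ v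
    simp only [φ, hv, Matrix.mulVec_mulVec, ← pow_succ (M := Matrix (Fin n) (Fin n) ℝ)]
    have hshift : ∑ j ∈ Finset.range m, (r ^ j)⁻¹ * ‖(M ^ (j + 1)) *ᵥ v.ofLp‖ =
        r * ∑ j ∈ Finset.range m, (r ^ (j + 1))⁻¹ * ‖(M ^ (j + 1)) *ᵥ v.ofLp‖ := by
      rw [Finset.mul_sum]
      refine Finset.sum_congr rfl fun j _ => ?_
      rw [pow_succ r]
      field_simp
    rw [hshift]
    refine mul_le_mul_of_nonneg_left ?_ hr0.le
    have hlast : (r ^ m)⁻¹ * ‖(M ^ m) *ᵥ v.ofLp‖ ≤ ‖v.ofLp‖ := by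
      rw [inv_mul_le_iff₀ (by positivity)]
      exact (Matrix.linfty_opNorm_mulVec _ _).trans (by gcongr)
    have := Finset.sum_range_succ (fun j => (r ^ j)⁻¹ * ‖(M ^ j) *ᵥ v.ofLp‖) m
    rw [Finset.sum_range_succ'] at this
    simp only [pow_zero, inv_one, one_mul, Matrix.one_mulVec] at this
    linarith

end Hurwitz

/-! ### Right derivatives up to a bounded error -/

/-- To the right of `t`, the curve `γ` has difference quotients that are asymptotically at
distance at most `U` from `g`. -/
def HasRightSlopeWithin {E : Type*} [NormedAddCommGroup E] [NormedSpace ℝ E]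
    (γ : ℝ → E) (g : E) (U t : ℝ) : Prop :=
  ∀ η > 0, ∀ᶠ s in 𝓝[>] t, ‖γ s - γ t - (s - t) • g‖ ≤ (s - t) * (U + η)

section Slope

variable {E F : Type*} [NormedAddCommGroup E] [NormedSpace ℝ E] [NormedAddCommGroup F]
  [NormedSpace ℝ F]

theorem HasRightSlopeWithin.mono {γ : ℝ → E} {g : E} {U U' t : ℝ}
    (hγ : HasRightSlopeWithin γ g U t) (hU : U ≤ U') : HasRightSlopeWithin γ g U' t := by
  intro η hη
  filter_upwards [hγ η hη, self_mem_nhdsWithin] with s hs hst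
  have : 0 ≤ s - t := sub_nonneg.2 (le_of_lt hst)
  exact hs.trans (by gcongr)

theorem HasRightSlopeWithin.sub {γ₁ γ₂ : ℝ → E} {g₁ g₂ : E} {U₁ U₂ t : ℝ}
    (h₁ : HasRightSlopeWithin γ₁ g₁ U₁ t) (h₂ : HasRightSlopeWithin γ₂ g₂ U₂ t) :
    HasRightSlopeWithin (fun s => γ₁ s - γ₂ s) (g₁ - g₂) (U₁ + U₂) t := by
  intro η hη
  filter_upwards [h₁ (η / 2) (by positivity), h₂ (η / 2) (by positivity)] with s hs₁ hs₂
  calc ‖γ₁ s - γ₂ s - (γ₁ t - γ₂ t) - (s - t) • (g₁ - g₂)‖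
      = ‖(γ₁ s - γ₁ t - (s - t) • g₁) - (γ₂ s - γ₂ t - (s - t) • g₂)‖ := by
        congr 1; rw [smul_sub]; abel
    _ ≤ (s - t) * (U₁ + η / 2) + (s - t) * (U₂ + η / 2) := (norm_sub_le _ _).trans (by gcongr)
    _ = _ := by ring

theorem hasRightSlopeWithin_of_hasDerivWithinAt {γ : ℝ → E} {g : E} {t : ℝ}
    (hγ : HasDerivWithinAt γ g (Ioi t) t) : HasRightSlopeWithin γ g 0 t := by
  intro η hη
  filter_upwards [hγ.isLittleO.def hη, self_mem_nhdsWithin] with s hs hst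
  rw [Real.norm_of_nonneg (sub_nonneg.2 (le_of_lt hst))] at hs
  rw [zero_add, mul_comm]
  exact hs

/-- Composition with a map that is differentiable relative to a set containing the curve. -/
theorem HasRightSlopeWithin.comp {γ : ℝ → E} {g : E} {U t : ℝ} {T : E → F} {T' : E →L[ℝ] F}
    {X : Set E} (hγ : HasRightSlopeWithin γ g U t) (hU : 0 ≤ U)
    (hcont : ContinuousWithinAt γ (Ioi t) t) (hX : ∀ s, t < s → γ s ∈ X)
    (hT : HasFDerivWithinAt T T' X (γ t)) :
    HasRightSlopeWithin (fun s => T (γ s)) (T' g) (‖T'‖ * U) t := by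
  intro η hη
  have htend : Tendsto γ (𝓝[>] t) (𝓝[X] (γ t)) :=
    tendsto_nhdsWithin_iff.2 ⟨hcont, eventually_nhdsWithin_of_forall hX⟩
  -- Half of `η` pays for the remainder of `T`, which is relative to `‖γ s - γ t‖ ≤ (s - t)(‖g‖ + U
  -- + 1)`; the other half pays for the slope error of `γ` magnified by `‖T'‖`.
  have hG : 0 < ‖g‖ + U + 1 := by positivity
  have hη₁ : 0 < η / (2 * (‖g‖ + U + 1)) := by positivity
  have hη₂ : 0 < η / (2 * (‖T'‖ + 1)) := by positivity
  filter_upwards [htend.eventually (hT.isLittleO.def hη₁), hγ 1 one_pos, hγ _ hη₂,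
    self_mem_nhdsWithin] with s hs₁ hs₂ hs₃ hst
  have hst' : 0 ≤ s - t := sub_nonneg.2 (le_of_lt hst)
  have hinc : ‖γ s - γ t‖ ≤ (s - t) * (‖g‖ + U + 1) :=
    calc ‖γ s - γ t‖ = ‖(γ s - γ t - (s - t) • g) + (s - t) • g‖ := by rw [sub_add_cancel]
      _ ≤ (s - t) * (U + 1) + (s - t) * ‖g‖ := by
        refine (norm_add_le _ _).trans (add_le_add hs₂ ?_)
        rw [norm_smul, Real.norm_of_nonneg hst']
      _ = _ := by ring
  calc ‖T (γ s) - T (γ t) - (s - t) • T' g‖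
      = ‖(T (γ s) - T (γ t) - T' (γ s - γ t)) + T' (γ s - γ t - (s - t) • g)‖ := by
        rw [map_sub T' _ ((s - t) • g), map_smul, sub_add_sub_cancel]
    _ ≤ η / (2 * (‖g‖ + U + 1)) * ((s - t) * (‖g‖ + U + 1)) +
          ‖T'‖ * ((s - t) * (U + η / (2 * (‖T'‖ + 1)))) := by
        refine (norm_add_le _ _).trans (add_le_add (hs₁.trans (by gcongr)) ?_)
        exact (T'.le_opNorm _).trans (by gcongr)
    _ = (s - t) * (‖T'‖ * U + η / 2 + ‖T'‖ / (‖T'‖ + 1) * (η / 2)) := by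
        field_simp
        ring
    _ ≤ (s - t) * (‖T'‖ * U + η / 2 + 1 * (η / 2)) := by
        gcongr
        rw [div_le_one (by positivity)]
        linarith
    _ = _ := by ring

/-- A primitive of `q`, where `q` is within `U` of the function `g` almost everywhere. -/
theorem hasRightSlopeWithin_of_integral [CompleteSpace E] {γ q g : ℝ → E} {γ₀ : E} {U t : ℝ}
    (hγ : ∀ s, 0 ≤ s → IntervalIntegrable q volume 0 s ∧ γ s = γ₀ + ∫ τ in (0 : ℝ)..s, q τ)
    (hg : ContinuousWithinAt g (Ioi t) t)
    (hU : ∀ᵐ τ ∂(volume.restrict (Ici (0 : ℝ))), ‖q τ - g τ‖ ≤ U) (ht : 0 ≤ t) :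
    HasRightSlopeWithin γ (g t) U t := by
  intro η hη
  obtain ⟨δ, hδ, hgδ⟩ := Metric.continuousWithinAt_iff.1 hg η hη
  filter_upwards [Ioo_mem_nhdsGT (lt_add_of_pos_right t hδ)] with s hs
  have hs0 : 0 ≤ s := ht.trans hs.1.le
  have hts : IntervalIntegrable q volume t s := (hγ t ht).1.symm.trans (hγ s hs0).1
  -- The integrand on the right is at most `U + η` almost everywhere once `g` varies by at most `η`
  -- on `(t, s]`.
  have heq : γ s - γ t - (s - t) • g t = ∫ τ in t..s, (q τ - g t) := by
    rw [intervalIntegral.integral_sub hts intervalIntegrable_const,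
      intervalIntegral.integral_const, (hγ s hs0).2, (hγ t ht).2, add_sub_add_left_eq_sub,
      intervalIntegral.integral_interval_sub_left (hγ s hs0).1 (hγ t ht).1]
  rw [heq, mul_comm, ← abs_of_nonneg (sub_nonneg.2 hs.1.le)]
  refine intervalIntegral.norm_integral_le_of_norm_le_const_ae ?_
  rw [ae_restrict_iff' measurableSet_Ici] at hU
  filter_upwards [hU] with τ hτ hmem
  rw [uIoc_of_le hs.1.le] at hmem
  have h1 := hτ (ht.trans hmem.1.le)
  have h2 : ‖g τ - g t‖ ≤ η := by
    rw [← dist_eq_norm]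
    refine (hgδ hmem.1 ?_).le
    rw [Real.dist_eq, abs_lt]
    constructor <;> linarith [hmem.1, hmem.2, hs.2]
  calc ‖q τ - g t‖ = ‖(q τ - g τ) + (g τ - g t)‖ := by rw [sub_add_sub_cancel]
    _ ≤ U + η := (norm_add_le _ _).trans (add_le_add h1 h2)

end Slope

/-! ### Bounded signals and input-to-state stability of the linear error -/

/-- A signal bounded by `wbar` in `L^∞` is bounded in the Euclidean norm almost everywhere. -/
theorem exists_norm_le_of_isSignalBoundedBy (n : ℕ) :
    ∃ C : ℝ, 0 < C ∧ ∀ (w : ℝ → Vec n) (wbar : ℝ), IsSignalBoundedBy w wbar →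
      ∀ᵐ t ∂(volume.restrict (Ici (0 : ℝ))), ‖w t‖ ≤ C * wbar := by
  obtain ⟨K, hK⟩ : ∃ K : ℝ≥0, LipschitzWith K (WithLp.toLp 2 : (Fin n → ℝ) → Vec n) :=
    ⟨_, PiLp.lipschitzWith_toLp 2 _⟩
  refine ⟨K + 1, by positivity, fun w wbar ⟨_, hw0, hw⟩ => ?_⟩
  have hae := ae_le_eLpNormEssSup (f := fun t => (WithLp.ofLp (w t) : Fin n → ℝ))
    (μ := volume.restrict (Ici (0 : ℝ)))
  filter_upwards [hae] with t ht
  have h1 : ‖(w t).ofLp‖ ≤ wbar := by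
    rw [linfNorm, eLpNorm_exponent_top] at hw
    have := ht.trans hw
    rwa [← ofReal_norm, ENNReal.ofReal_le_ofReal_iff hw0] at this
  have h2 : ‖w t‖ ≤ K * ‖(w t).ofLp‖ := by simpa using hK.dist_le_mul (w t).ofLp 0
  nlinarith [mul_le_mul_of_nonneg_left h1 K.coe_nonneg]

/-- Exponential input-to-state stability of `e' = A e + d(t)`, `‖d‖ ≤ D`, for Hurwitz `A`. -/
theorem IsHurwitz.exists_exp_bound {n : ℕ} {A : Matrix (Fin n) (Fin n) ℝ} (hA : IsHurwitz A) :
    ∃ c K : ℝ, 0 < c ∧ 0 < K ∧ ∀ (D : ℝ) (e : ℝ → Vec n), 0 ≤ D → ContinuousOn e (Ici 0) →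
      (∀ t, 0 ≤ t → HasRightSlopeWithin e (Matrix.toEuclideanLin A (e t)) D t) →
      ∀ t, 0 ≤ t → ‖e t‖ ≤ K * Real.exp (-c * t) * ‖e 0‖ + K * D := by
  obtain ⟨p, h, r, C₁, C₂, hh, hr, hC₁, hC₂, hp₁, hp₂, hstep⟩ := hA.exists_seminorm
  set c := (1 - r) / h with hc
  have hcpos : 0 < c := div_pos (sub_pos.2 hr) hh
  refine ⟨c, C₁ * C₂ + C₁ * C₂ / c, hcpos, by positivity, fun D e hD he hslope t ht => ?_⟩
  have hpcont : Continuous p := by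
    refine (LipschitzWith.of_le_add_mul ⟨C₂, hC₂.le⟩ fun u v => ?_).continuous
    calc p u = p (v + (u - v)) := by rw [add_sub_cancel]
      _ ≤ p v + C₂ * ‖u - v‖ := (map_add_le_add p _ _).trans (by gcongr; exact hp₂ _)
      _ = _ := by rw [dist_eq_norm]; rfl
  -- The contraction for the full step `h` passes to every shorter Euler step by convexity of `p`,
  -- with the rate `c = (1 - r) / h`.
  have hdecr (v : Vec n) (δ : ℝ) (hδ : 0 ≤ δ) (hδh : δ ≤ h) :
      p (v + δ • Matrix.toEuclideanLin A v) ≤ p v - δ * c * p v := by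
    have hconv : v + δ • Matrix.toEuclideanLin A v =
        (1 - δ / h) • v + (δ / h) • (v + h • Matrix.toEuclideanLin A v) := by
      rw [smul_add, smul_smul, div_mul_cancel₀ _ hh.ne', ← add_assoc, ← add_smul,
        sub_add_cancel, one_smul]
    have h1 : 0 ≤ 1 - δ / h := sub_nonneg.2 ((div_le_one hh).2 hδh)
    have h2 : 0 ≤ δ / h := by positivity
    rw [hconv]
    calc p ((1 - δ / h) • v + (δ / h) • (v + h • Matrix.toEuclideanLin A v))
        ≤ (1 - δ / h) * p v + δ / h * (r * p v) := by
          refine (map_add_le_add p _ _).trans ?_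
          rw [map_smul_eq_mul, map_smul_eq_mul, Real.norm_of_nonneg h1, Real.norm_of_nonneg h2]
          gcongr
          exact hstep v
      _ = p v - δ * c * p v := by rw [hc]; field_simp; ring
  have hgron := le_gronwallBound_of_liminf_deriv_right_le (f := fun s => p (e s))
    (f' := fun s => -c * p (e s) + C₂ * D) (δ := p (e 0)) (K := -c) (ε := C₂ * D) (a := 0) (b := t)
    (hpcont.comp_continuousOn (he.mono Icc_subset_Ici_self)) ?_ le_rfl (fun _ _ => le_rfl) t
    ⟨ht, le_rfl⟩
  · rw [gronwallBound_of_K_ne_0 (neg_ne_zero.2 hcpos.ne'), sub_zero] at hgron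
    have hE : 0 < Real.exp (-c * t) := Real.exp_pos _
    have hsmall : C₂ * D / -c * (Real.exp (-c * t) - 1) ≤ C₂ * D / c := by
      have : 0 ≤ C₂ * D / c * Real.exp (-c * t) := by positivity
      rw [div_neg]
      linarith
    calc ‖e t‖ ≤ C₁ * p (e t) := hp₁ _
      _ ≤ C₁ * (C₂ * ‖e 0‖ * Real.exp (-c * t) + C₂ * D / c) := by
        gcongr
        refine hgron.trans (add_le_add ?_ hsmall)
        gcongr
        exact hp₂ _
      _ = C₁ * C₂ * Real.exp (-c * t) * ‖e 0‖ + C₁ * C₂ / c * D := by ring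
      _ ≤ _ := by
        gcongr
        · exact le_add_of_nonneg_right (by positivity)
        · exact le_add_of_nonneg_left (by positivity)
  · intro s hs ρ hρ
    set gap := ρ - (-c * p (e s) + C₂ * D) with hgap
    have hgap0 : 0 < gap := sub_pos.2 hρ
    refine Eventually.frequently ?_
    -- After multiplication by `C₂` the tolerance `gap / (2 * C₂)` costs only half of `gap`, which
    -- keeps the inequality strict.
    filter_upwards [hslope s hs.1 (gap / (2 * C₂)) (by positivity),
      Ioo_mem_nhdsGT (lt_add_of_pos_right s hh)] with τ hτ hτs
    have hδ : 0 < τ - s := sub_pos.2 hτs.1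
    rw [inv_mul_lt_iff₀ hδ]
    have hkey : p (e τ) ≤ p (e s) - (τ - s) * c * p (e s) +
        C₂ * ((τ - s) * (D + gap / (2 * C₂))) :=
      calc p (e τ) = p ((e s + (τ - s) • Matrix.toEuclideanLin A (e s)) +
            (e τ - e s - (τ - s) • Matrix.toEuclideanLin A (e s))) := by congr 1; abel
        _ ≤ _ := by
          refine (map_add_le_add p _ _).trans (add_le_add
            (hdecr _ _ hδ.le (by linarith [hτs.2])) ((hp₂ _).trans ?_))
          gcongr
    have hlast : C₂ * ((τ - s) * (D + gap / (2 * C₂))) =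
        (τ - s) * (C₂ * D) + (τ - s) * (gap / 2) := by field_simp
    have hhalf : (τ - s) * ρ = (τ - s) * gap + (τ - s) * (-c * p (e s) + C₂ * D) := by
      rw [hgap]; ring
    have : 0 < (τ - s) * gap := mul_pos hδ hgap0
    rw [hlast] at hkey
    rw [hhalf]
    linarith

/-! ### The map `T` along trajectories and the admissible regions -/

theorem SolvesPDE.continuousOn {nx ny nz : ℕ} {f : Vec nx → Vec nx} {h : Vec nx → Vec ny}
    {A : Matrix (Fin nz) (Fin nz) ℝ} {B : Matrix (Fin nz) (Fin ny) ℝ} {X : Set (Vec nx)}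
    {T : Vec nx → Vec nz} (hT : SolvesPDE f h A B X T) : ContinuousOn T X := by
  obtain ⟨_, _, hDT⟩ := hT
  exact fun x hx => (hDT x hx).1.continuousWithinAt

/-- The observer state driven by the nominal output is `T` along the nominal trajectory. -/
theorem SolvesPDE.eq_comp_trajectory {nx ny nz : ℕ} {f : Vec nx → Vec nx} {h : Vec nx → Vec ny}
    {A : Matrix (Fin nz) (Fin nz) ℝ} {B : Matrix (Fin nz) (Fin ny) ℝ} {X : Set (Vec nx)}
    {T : Vec nx → Vec nz} (hT : SolvesPDE f h A B X T) (hA : IsHurwitz A) {x₀ : Vec nx}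
    {x : ℝ → Vec nx} {z : ℝ → Vec nz} (hx : IsTrajectoryIn f X x₀ x) (hz0 : z 0 = T x₀)
    (hz : IsIntegralCurveOn z (linearField A B fun t => h (x t)) (Ici 0)) {t : ℝ} (ht : 0 ≤ t) :
    z t = T (x t) := by
  obtain ⟨hx0, hxf, hxX⟩ := hx
  obtain ⟨c, K, -, -, hbound⟩ := hA.exists_exp_bound
  have hTc := hT.continuousOn
  obtain ⟨DT, -, hDT⟩ := hT
  have hxc : ContinuousOn x (Ici 0) := fun s hs => (hxf s hs).continuousWithinAt
  have hzc : ContinuousOn z (Ici 0) := fun s hs => (hz s hs).continuousWithinAt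
  -- The difference solves `e' = A e` with `e(0) = 0`, so the stability bound with `D = 0` forces it
  -- to vanish.
  have := hbound 0 (fun s => z s - T (x s)) le_rfl
    (hzc.sub (hTc.comp hxc fun s hs => hxX s hs)) (fun s hs => ?_) t ht
  · simpa [hz0, hx0, sub_eq_zero] using this
  · have h1 := hasRightSlopeWithin_of_hasDerivWithinAt
      ((hz s hs).mono (Ioi_subset_Ici hs))
    have h2 := hasRightSlopeWithin_of_hasDerivWithinAt
      ((((hDT _ (hxX s hs)).1.comp_hasDerivWithinAt s (hxf s hs) fun τ hτ => hxX τ hτ)).mono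
        (Ioi_subset_Ici hs))
    have h3 := h1.sub h2
    simpa [linearField, (hDT _ (hxX s hs)).2] using h3

theorem exists_observerRegion {nx ny nz : ℕ} {X : Set (Vec nx)} {f : Vec nx → Vec nx}
    {h : Vec nx → Vec ny} (hX : IsCompact X) {A : Matrix (Fin nz) (Fin nz) ℝ}
    {B : Matrix (Fin nz) (Fin ny) ℝ} (hA : IsHurwitz A) {T : Vec nx → Vec nz}
    (hT : SolvesPDE f h A B X T) {Tinv : Vec nz → Vec nx} (hTinv : IsLeftInverseOn T X Tinv)
    {N : NeuralNet nz nx} (hN : Continuous N.eval) :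
    ∃ (Z : Set (Vec nz)) (ε : ℝ), IsObserverRegion f h A B X T Z ∧
      IsApproximationBound Tinv N Z ε := by
  have hTc := hT.continuousOn
  -- All observer trajectories in question stay in `T '' X`. The point `0` is added only to make the
  -- region nonempty when `X` is empty, so that a real supremum exists.
  refine ⟨insert 0 (T '' X), _, ⟨(hX.image_of_continuousOn hTc).insert 0,
    fun x₀ _ x z hx hz0 hz t ht => ?_⟩, isLUB_csSup ((insert_nonempty _ _).image _) ?_⟩
  · rw [hT.eq_comp_trajectory hA hx hz0 hz ht]
    exact mem_insert_of_mem _ (mem_image_of_mem T (hx.2.2 t ht))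
  · rw [image_insert_eq, bddAbove_insert, image_image]
    -- `Tinv` need not be continuous, but on `T '' X` the error reads `x - N(T x)`, which is
    -- continuous in `x`.
    have : ContinuousOn (fun x => ‖x - N.eval (T x)‖) X :=
      (continuousOn_id.sub (hN.comp_continuousOn hTc)).norm
    refine (hX.image_of_continuousOn this).bddAbove.mono ?_
    rintro _ ⟨x, hx, rfl⟩
    exact ⟨x, hx, by simp only [hTinv x hx]⟩

/-- By the PDE, `T` along a nominal trajectory is itself one of the curves that the region must
contain, and at time `0` it passes through `T x₀`. This puts `T(x(t))` in the region for perturbed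
`x` too, since only `x(t) ∈ X` matters. -/
theorem IsObserverRegion.image_subset {nx ny nz : ℕ} {f : Vec nx → Vec nx} {h : Vec nx → Vec ny}
    {A : Matrix (Fin nz) (Fin nz) ℝ} {B : Matrix (Fin nz) (Fin ny) ℝ} {X : Set (Vec nx)}
    {T : Vec nx → Vec nz} {Z : Set (Vec nz)} (hZ : IsObserverRegion f h A B X T Z)
    (hfc : ForwardCompleteWithin f X) (hT : SolvesPDE f h A B X T) : T '' X ⊆ Z := by
  rintro _ ⟨x₀, hx₀, rfl⟩
  obtain ⟨x, hx⟩ := hfc x₀ hx₀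
  obtain ⟨DT, -, hDT⟩ := hT
  have := hZ.2 x₀ hx₀ x (fun t => T (x t)) hx (by rw [hx.1]) (fun t ht => ?_) 0 le_rfl
  · rwa [hx.1] at this
  · have h1 := hDT _ (hx.2.2 t ht)
    rw [linearField, ← h1.2]
    exact h1.1.comp_hasDerivWithinAt t (hx.2.1 t ht) fun τ hτ => hx.2.2 τ hτ

/-- Input-to-state stability of the observer error in the coordinates `z = T(x)`. -/
theorem exists_observer_error_bound {nx ny nz : ℕ} {X : Set (Vec nx)} {f : Vec nx → Vec nx}
    {h : Vec nx → Vec ny} (hX : IsCompact X) (hf : ContinuousOn f X) (hh : ContinuousOn h X)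
    {A : Matrix (Fin nz) (Fin nz) ℝ} {B : Matrix (Fin nz) (Fin ny) ℝ} (hA : IsHurwitz A)
    {T : Vec nx → Vec nz} (hT : SolvesPDE f h A B X T) :
    ∃ c K β₁ β₂ : ℝ, 0 < c ∧ 0 < K ∧ 0 ≤ β₁ ∧ 0 ≤ β₂ ∧
      ∀ (wbar vbar : ℝ) (w : ℝ → Vec nx) (v : ℝ → Vec ny),
        IsSignalBoundedBy w wbar → IsSignalBoundedBy v vbar →
      ∀ (x₀ : Vec nx) (zhat₀ : Vec nz) (x : ℝ → Vec nx) (y : ℝ → Vec ny) (zhat : ℝ → Vec nz),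
        IsCaratheodorySolution (fun t ξ => f ξ + w t) x₀ x →
        (∀ t : ℝ, 0 ≤ t → x t ∈ X) →
        (∀ t : ℝ, 0 ≤ t → y t = h (x t) + v t) →
        IsCaratheodorySolution (linearField A B y) zhat₀ zhat →
      ∀ t : ℝ, 0 ≤ t → ‖zhat t - T (x t)‖
        ≤ K * Real.exp (-c * t) * ‖zhat₀ - T x₀‖ + β₁ * wbar + β₂ * vbar := by
  obtain ⟨c, K, hc, hK, hbound⟩ := hA.exists_exp_bound
  have hTc := hT.continuousOn
  obtain ⟨DT, hDTc, hDT⟩ := hT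
  obtain ⟨M, hM⟩ := (hX.image_of_continuousOn hDTc).isBounded.exists_norm_le
  obtain ⟨Cw, hCw, hw⟩ := exists_norm_le_of_isSignalBoundedBy nx
  obtain ⟨Cv, hCv, hv⟩ := exists_norm_le_of_isSignalBoundedBy ny
  set Bl := LinearMap.toContinuousLinearMap (Matrix.toEuclideanLin B) with hBl
  set Al := LinearMap.toContinuousLinearMap (Matrix.toEuclideanLin A) with hAl
  -- `M` bounds `‖DT‖` on `X`; the absolute value is needed because the bound could be negative for
  -- empty `X`. `Cw` and `Cv` convert maximum norms to Euclidean ones.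
  refine ⟨c, K, K * (|M| * Cw), K * (‖Bl‖ * Cv), hc, hK, by positivity, by positivity, ?_⟩
  intro wbar vbar w v hwb hvb x₀ zhat₀ x y zhat hx hxX hy hz t ht
  have hw0 := hwb.2.1
  have hv0 := hvb.2.1
  have hxinit : x 0 = x₀ := by simpa using (hx.2 0 le_rfl).2
  have hzinit : zhat 0 = zhat₀ := by simpa using (hz.2 0 le_rfl).2
  have hfx : ContinuousOn (fun s => f (x s)) (Ici 0) := hf.comp hx.1 fun s hs => hxX s hs
  have hhx : ContinuousOn (fun s => Al (zhat s) + Bl (h (x s))) (Ici 0) :=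
    (Al.continuous.comp_continuousOn hz.1).add
      (Bl.continuous.comp_continuousOn (hh.comp hx.1 fun s hs => hxX s hs))
  have := hbound (|M| * (Cw * wbar) + ‖Bl‖ * (Cv * vbar)) (fun s => zhat s - T (x s))
    (by positivity) (hz.1.sub (hTc.comp hx.1 fun s hs => hxX s hs)) (fun s hs => ?_) t ht
  · simp only [hxinit, hzinit] at this
    linarith
  · have hsub : Ioi s ⊆ Ici 0 := Ioi_subset_Ici hs
    have hxs : HasRightSlopeWithin x (f (x s)) (Cw * wbar) s := by
      refine hasRightSlopeWithin_of_integral (g := fun τ => f (x τ)) hx.2 ((hfx s hs).mono hsub)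
        ?_ hs
      filter_upwards [hw w wbar hwb] with τ hτ
      simpa using hτ
    have hzs : HasRightSlopeWithin zhat (Al (zhat s) + Bl (h (x s))) (‖Bl‖ * (Cv * vbar)) s := by
      refine hasRightSlopeWithin_of_integral (g := fun τ => Al (zhat τ) + Bl (h (x τ))) hz.2
        ((hhx s hs).mono hsub) ?_ hs
      filter_upwards [hv v vbar hvb, ae_restrict_mem measurableSet_Ici] with τ hτ hτ0
      have : linearField A B y τ (zhat τ) - (Al (zhat τ) + Bl (h (x τ))) = Bl (v τ) := by
        change Al (zhat τ) + Bl (y τ) - _ = _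
        rw [hy τ hτ0, map_add]
        abel
      rw [this]
      exact (Bl.le_opNorm _).trans (by gcongr)
    have hTs := (hxs.comp (by positivity) ((hx.1 s hs).mono hsub)
      (fun τ hτ => hxX τ (hs.trans (le_of_lt hτ))) (hDT _ (hxX s hs)).1).mono
        (mul_le_mul_of_nonneg_right
          ((hM _ (mem_image_of_mem _ (hxX s hs))).trans (le_abs_self M)) (by positivity))
    have hsub' := hzs.sub hTs
    -- Here the PDE removes `h(x)` and leaves a field linear in the error.
    have heq : Al (zhat s) + Bl (h (x s)) - DT (x s) (f (x s)) =
        Matrix.toEuclideanLin A (zhat s - T (x s)) := by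
      rw [(hDT _ (hxX s hs)).2, map_sub]
      change Al (zhat s) + Bl (h (x s)) - (Al (T (x s)) + Bl (h (x s))) = Al _ - Al _
      abel
    rw [heq, add_comm (‖Bl‖ * _)] at hsub'
    exact hsub'

end KKL

/-! ### The estimate in the original coordinates -/

theorem mainTheorem2 {nx ny nz : ℕ} (hnz : nz = ny * (2 * nx + 1))
    -- the nominal system and the two standing assumptions
    (X O : Set (KKL.Vec nx)) (f : KKL.Vec nx → KKL.Vec nx) (h : KKL.Vec nx → KKL.Vec ny)
    (hX : IsCompact X) (hO : IsOpen O) (hOb : Bornology.IsBounded O) (hXO : X ⊆ O)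
    (hf : ContDiffOn ℝ ∞ f O) (hh : ContDiffOn ℝ ∞ h O)
    (hfc : KKL.ForwardCompleteWithin f X)
    (hbd : KKL.BackwardDistinguishable f h O X)
    -- the observer: linear part, transformation, left inverse and network replacing it
    (A : Matrix (Fin nz) (Fin nz) ℝ) (B : Matrix (Fin nz) (Fin ny) ℝ)
    (hA : KKL.IsHurwitz A) (hAB : KKL.IsControllable A B)
    (T : KKL.Vec nx → KKL.Vec nz) (hTinj : KKL.UniformlyInjectiveOn T X)
    (hT : KKL.SolvesPDE f h A B X T)
    (Tinv : KKL.Vec nz → KKL.Vec nx) (hTinv : KKL.IsLeftInverseOn T X Tinv)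
    (N : KKL.NeuralNet nz nx) (hN : N.LipschitzActivations) :
    -- there is a region with a finite approximation bound
    (∃ (Z : Set (KKL.Vec nz)) (ε : ℝ),
      KKL.IsObserverRegion f h A B X T Z ∧ KKL.IsApproximationBound Tinv N Z ε) ∧
    -- and the input-to-state estimate holds for every such region
    ∃ c α₁ α₂ : ℝ, 0 < c ∧ 0 < α₁ ∧ 0 < α₂ ∧
      ∀ zhat₀ : KKL.Vec nz, ∃ b : ℝ, 0 < b ∧
        ∀ (Z : Set (KKL.Vec nz)) (ε : ℝ),
          KKL.IsObserverRegion f h A B X T Z → KKL.IsApproximationBound Tinv N Z ε →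
        ∀ (wbar vbar : ℝ) (w : ℝ → KKL.Vec nx) (v : ℝ → KKL.Vec ny),
          KKL.IsSignalBoundedBy w wbar → KKL.IsSignalBoundedBy v vbar →
        ∀ (x₀ : KKL.Vec nx) (x : ℝ → KKL.Vec nx) (y : ℝ → KKL.Vec ny) (zhat : ℝ → KKL.Vec nz),
          KKL.IsCaratheodorySolution (fun t ξ => f ξ + w t) x₀ x →
          (∀ t : ℝ, 0 ≤ t → x t ∈ X) →
          (∀ t : ℝ, 0 ≤ t → y t = h (x t) + v t) →
          KKL.IsCaratheodorySolution (KKL.linearField A B y) zhat₀ zhat →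
        ∀ t : ℝ, 0 ≤ t →
          ‖N.eval (zhat t) - x t‖
            ≤ b * Real.exp (-c * t) + α₁ * wbar + α₂ * vbar + ε := by

  obtain ⟨L, hL⟩ := N.exists_lipschitzWith_eval hN
  refine ⟨KKL.exists_observerRegion hX hA hT hTinv hL.continuous, ?_⟩
  obtain ⟨c, K, β₁, β₂, hc, hK, hβ₁, hβ₂, hbound⟩ := KKL.exists_observer_error_bound hX
    (hf.continuousOn.mono hXO) (hh.continuousOn.mono hXO) hA hT
  obtain ⟨R, hR⟩ := (hX.image_of_continuousOn hT.continuousOn).isBounded.exists_norm_le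
  -- The summands `1` make the constants positive even if `L` or some `β` is zero. Bounding `T x₀`
  -- by `|R|` over all of `X` makes `b` depend on `zhat₀` but not on the trajectory.
  refine ⟨c, L * β₁ + 1, L * β₂ + 1, hc, by positivity, by positivity, fun zhat₀ =>
    ⟨L * (K * (‖zhat₀‖ + |R|)) + 1, by positivity, ?_⟩⟩
  intro Z ε hZ hε wbar vbar w v hw hv x₀ x y zhat hx hxX hy hz t ht
  have hx₀ : x₀ ∈ X := by
    have := hxX 0 le_rfl
    rwa [show x 0 = x₀ by simpa using (hx.2 0 le_rfl).2] at this
  have hTx : T (x t) ∈ Z := hZ.image_subset hfc hT (Set.mem_image_of_mem T (hxX t ht))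
  have happrox : ‖N.eval (T (x t)) - x t‖ ≤ ε := by
    have := hε.1 (Set.mem_image_of_mem _ hTx)
    simp only [hTinv _ (hxX t ht)] at this
    rwa [norm_sub_rev]
  have hinit : ‖zhat₀ - T x₀‖ ≤ ‖zhat₀‖ + |R| :=
    (norm_sub_le _ _).trans
      (add_le_add le_rfl ((hR _ (Set.mem_image_of_mem T hx₀)).trans (le_abs_self R)))
  have herr := hbound wbar vbar w v hw hv x₀ zhat₀ x y zhat hx hxX hy hz t ht
  have hexp := Real.exp_pos (-c * t)
  calc ‖N.eval (zhat t) - x t‖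
      ≤ ‖N.eval (zhat t) - N.eval (T (x t))‖ + ‖N.eval (T (x t)) - x t‖ :=
        norm_sub_le_norm_sub_add_norm_sub _ _ _
    _ ≤ L * (K * Real.exp (-c * t) * (‖zhat₀‖ + |R|) + β₁ * wbar + β₂ * vbar) + ε := by
        refine add_le_add ((hL.norm_sub_le _ _).trans ?_) happrox
        gcongr
        refine herr.trans ?_
        gcongr
    _ ≤ _ := by linarith [hw.2.1, hv.2.1]
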